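/- Let $K$ be an algebraically closed field of characteristic zero, and let $Z\subset K^3$ be an irreducible algebraic surface with (irreducible) defining polynomial $f\in K[x,y,z]$. Let $$Q(t,s)=\left(\frac{N_1(t,s)}{D_1(t,s)},\frac{N_2(t,s)}{D_2(t,s)},\frac{N_3(t,s)}{D_3(t,s)}\right),\qquad N_i,D_i\in K[t,s],\ D_i\neq 0,\ \gcd(N_i,D_i)=1,$$ be a rational parametrization of $Z$ (not necessarily proper), i.e. $Z$ is the Zariski closure of the set of values of $Q$ at the parameters where it is defined. For $A=(a,b,c)\in K^3$ put $$\Phi_{2,3}(A)=(\chi_1^A,\chi_2^A)=\left(\frac{N_2-bD_2}{N_1-aD_1}\cdot\frac{D_1}{D_2},\ \frac{N_3-cD_3}{N_1-aD_1}\cdot\frac{D_1}{D_3}\right).$$ Let $g_i^{Q,A}\in K[h_1,h_2][t,s]$ be the numerator, in reduced form, of $\chi_i^A(t,s)-\chi_i^A(h_1,h_2)$, where $h_1,h_2$ are new variables, and let $g^{Q,A}$ be $\gcd(g_1^{Q,A},g_2^{Q,A})$ if this gcd has positive degree in $\{t,s\}$, and $g^{Q,A}=1$ otherwise. The degree of a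 rational map $K^2\to K^m$ with components $\psi_1,\dots,\psi_m\in K(t,s)$ is the degree of the field extension $[K(t,s):K(\psi_1,\dots,\psi_m)]$ (with the convention that it is $0$ if the extension is infinite). The multiplicity of $A$ on $Z$ is the least degree of a nonzero homogeneous component of $f(x+a,y+b,z+c)$, and $A$ is a simple point of $Z$ if this multiplicity is $1$. Assume that $Z$ is not a plane, let $A_0\in K^3\setminus Z$ and let $A\in K^3$. Then $A$ is a simple point of $Z$ if and only if $$g^{Q,A}=1\quad\text{and}\quad \deg\Phi_{2,3}(A_0)-\deg\Phi_{2,3}(A)=\deg(Q).$$ -/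

import Mathlib

noncomputable section

namespace RationalSurface

open MvPolynomial

variable {K : Type*} [Field K]

/-! ### Surfaces in affine 3-space, planes, multiplicities -/

/-- `f` is a defining polynomial of the (irreducible) affine surface `Z` in `K³`. -/
def IsDefiningPolynomial (f : MvPolynomial (Fin 3) K) (Z : Set (Fin 3 → K)) : Prop :=
  Irreducible f ∧ Z = {P | eval P f = 0}

/-- `Z` is a plane: the zero set of a polynomial of total degree one. -/
def IsPlane (Z : Set (Fin 3 → K)) : Prop :=
  ∃ l : MvPolynomial (Fin 3) K, l.totalDegree = 1 ∧ Z = {P | eval P l = 0}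

/-- The translated polynomial `f(x + a, y + b, z + c)`, for `A = (a, b, c)`. -/
def translate (A : Fin 3 → K) (f : MvPolynomial (Fin 3) K) : MvPolynomial (Fin 3) K :=
  aeval (fun i => X i + C (A i)) f

/-- The multiplicity at `A` of the surface with defining polynomial `f`: the least degree of a
nonzero homogeneous component of `f(x + a, y + b, z + c)`. It is `0` exactly off the surface. -/
def multiplicityAt (f : MvPolynomial (Fin 3) K) (A : Fin 3 → K) : ℕ :=
  sInf {n | homogeneousComponent n (translate A f) ≠ 0}

/-- `A` is a simple point of the surface with defining polynomial `f`: the multiplicity is one. -/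
def IsSimplePoint (f : MvPolynomial (Fin 3) K) (A : Fin 3 → K) : Prop :=
  multiplicityAt f A = 1

/-! ### Rational parametrizations `(N₁/D₁, N₂/D₂, N₃/D₃)` -/

/-- The values of the parametrization at the parameters where it is defined. -/
def paramImage (N D : Fin 3 → MvPolynomial (Fin 2) K) : Set (Fin 3 → K) :=
  {P | ∃ u : Fin 2 → K, (∀ i, eval u (D i) ≠ 0) ∧ ∀ i, P i = eval u (N i) / eval u (D i)}

/-- `(N₁/D₁, N₂/D₂, N₃/D₃)` is a rational parametrization, in reduced form, of `Z`:
`Z` is the Zariski closure of its image. -/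
structure IsParametrization (N D : Fin 3 → MvPolynomial (Fin 2) K)
    (Z : Set (Fin 3 → K)) : Prop where
  den_ne_zero : ∀ i, D i ≠ 0
  reduced : ∀ i, IsRelPrime (N i) (D i)
  closure_image : zeroLocus K (vanishingIdeal K (paramImage N D)) = Z

variable (K) in
/-- The field `K(t, s)` of rational functions in the two parameters. -/
abbrev RatFun : Type _ := FractionRing (MvPolynomial (Fin 2) K)

/-- A polynomial in `t, s`, as a rational function. -/
abbrev toRat (p : MvPolynomial (Fin 2) K) : RatFun K :=
  algebraMap (MvPolynomial (Fin 2) K) (RatFun K) p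

/-- The triple of rational functions `(N₁/D₁, N₂/D₂, N₃/D₃)`. -/
def paramFun (N D : Fin 3 → MvPolynomial (Fin 2) K) : Fin 3 → RatFun K :=
  fun i => toRat (N i) / toRat (D i)

/-- The degree of the rational map `K² → Kᵐ` with components `χ`, as a map onto the Zariski
closure `W` of its image: the degree of the extension `K(t, s) / K(W)`, where the function field
`K(W)` is pulled back to `K(χ₁, …, χₘ)`. (It is `0` if the extension is infinite.) -/
def ratMapDegree {m : ℕ} (χ : Fin m → RatFun K) : ℕ :=
  Module.finrank (IntermediateField.adjoin K (Set.range χ)) (RatFun K)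

/-- The two components of `Φ_{2,3}(A)`, where `A = (a, b, c)`:
`(N₂ - b D₂)/(N₁ - a D₁) · D₁/D₂` and `(N₃ - c D₃)/(N₁ - a D₁) · D₁/D₃`. -/
def Phi (N D : Fin 3 → MvPolynomial (Fin 2) K) (A : Fin 3 → K) : Fin 2 → RatFun K :=
  ![toRat (N 1 - C (A 1) * D 1) / toRat (N 0 - C (A 0) * D 0) * (toRat (D 0) / toRat (D 1)),
    toRat (N 2 - C (A 2) * D 2) / toRat (N 0 - C (A 0) * D 0) * (toRat (D 0) / toRat (D 2))]

/-! ### The gcd polynomial of `Φ_{2,3}(A)` -/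

variable (K) in
/-- The ring `K[h₁, h₂][t, s]`: the outer variables are `t, s`, the inner ones `h₁, h₂`. -/
abbrev DoublePoly : Type _ := MvPolynomial (Fin 2) (MvPolynomial (Fin 2) K)

variable (K) in
/-- `p(t, s) ↦ p(t, s)`, from `K[t, s]` to the fraction field of `K[h₁, h₂][t, s]`. -/
def polyInTS : MvPolynomial (Fin 2) K →+* FractionRing (DoublePoly K) :=
  (algebraMap (DoublePoly K) (FractionRing (DoublePoly K))).comp
    (MvPolynomial.map (C : K →+* MvPolynomial (Fin 2) K))

variable (K) in
/-- `p(t, s) ↦ p(h₁, h₂)`, from `K[t, s]` to the fraction field of `K[h₁, h₂][t, s]`. -/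
def polyInH : MvPolynomial (Fin 2) K →+* FractionRing (DoublePoly K) :=
  (algebraMap (DoublePoly K) (FractionRing (DoublePoly K))).comp
    (C : MvPolynomial (Fin 2) K →+* DoublePoly K)

theorem polyInTS_injective : Function.Injective (polyInTS K) :=
  (IsFractionRing.injective (DoublePoly K) (FractionRing (DoublePoly K))).comp
    (MvPolynomial.map_injective _ (MvPolynomial.C_injective (Fin 2) K))

theorem polyInH_injective : Function.Injective (polyInH K) :=
  (IsFractionRing.injective (DoublePoly K) (FractionRing (DoublePoly K))).comp
    (MvPolynomial.C_injective (Fin 2) (MvPolynomial (Fin 2) K))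

/-- The rational function `χ(t, s)`, seen in the fraction field of `K[h₁, h₂][t, s]`. -/
def inTS (χ : RatFun K) : FractionRing (DoublePoly K) :=
  IsFractionRing.lift (polyInTS_injective (K := K)) χ

/-- The rational function `χ(h₁, h₂)`, seen in the fraction field of `K[h₁, h₂][t, s]`. -/
def inH (χ : RatFun K) : FractionRing (DoublePoly K) :=
  IsFractionRing.lift (polyInH_injective (K := K)) χ

/-- The numerator, in reduced form, of `χ(t, s) - χ(h₁, h₂)`. -/
def diffNumer (χ : RatFun K) : DoublePoly K :=
  IsFractionRing.num (DoublePoly K) (inTS χ - inH χ)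

/-- A greatest common divisor in `K[h₁, h₂][t, s]` (determined up to a nonzero constant). -/
def doubleGcd (p q : DoublePoly K) : DoublePoly K :=
  letI := UniqueFactorizationMonoid.toGCDMonoid (DoublePoly K)
  gcd p q

/-- The polynomial `𝔤^{Q,A}`: the gcd of the numerators of `χ₁(t, s) - χ₁(h₁, h₂)` and
`χ₂(t, s) - χ₂(h₁, h₂)`, where `(χ₁, χ₂) = Φ_{2,3}(A)`, if this gcd has positive degree in `t, s`,
and `1` otherwise. -/
def gPoly (N D : Fin 3 → MvPolynomial (Fin 2) K) (A : Fin 3 → K) : DoublePoly K :=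
  if 0 < (doubleGcd (diffNumer (Phi N D A 0)) (diffNumer (Phi N D A 1))).totalDegree then
    doubleGcd (diffNumer (Phi N D A 0)) (diffNumer (Phi N D A 1))
  else 1

end RationalSurface

end

noncomputable section

namespace RationalSurface

open MvPolynomial
open scoped IntermediateField.algebraAdjoinAdjoin

universe u

variable {K : Type u} [Field K]

/-! Project $Z$ from $A$. Let $F$ be $f$ translated so that $A$ becomes the origin, and $m$ its
multiplicity there. Substituting $(w, ws, wt)$ gives $F = w^m G$ with $w \nmid G$ and $\deg_w G =
\deg f - m$. With $w$ the first coordinate of $Q - A$ and $\varphi = \Phi_{2,3}(A)$, one has $Q - A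
= (w, w\varphi_1, w\varphi_2)$, so $K(\varphi)(w) = K(Q)$, and $G$ generates the relations of
$(\varphi, w)$. Hence $G$ is, up to a constant, the minimal polynomial of $w$ over $K(\varphi)$
(`finrank_adjoin_eq_natDegree`), and the tower law gives $\deg\Phi_{2,3}(A) = (\deg f - m)\deg Q$
(`exists_ratMapDegree_Phi`). If $\deg_w G = 0$, both sides are $0$ by convention.

Subtracting from the case $m = 0$ at $A_0$ leaves $m \deg Q$ with $\deg Q > 0$, so the degree
condition alone says $m = 1$. The gcd condition is then automatic: as $Z$ is not a plane, $\deg f -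
1 > 0$, so $\varphi$ is algebraically independent, which forces a trivial gcd
(`gPoly_eq_one_of_algebraicIndependent`). -/

/-! ### The substitution `(x, y, z) = (w, w s, w t)` -/

/-- The substitution `x = w`, `y = w s`, `z = w t`, with values in `K[s, t][w]`. -/
def chart : MvPolynomial (Fin 3) K →ₐ[K] Polynomial (MvPolynomial (Fin 2) K) :=
  aeval ![Polynomial.X, Polynomial.X * Polynomial.C (X 0), Polynomial.X * Polynomial.C (X 1)]

/-- Dehomogenization with respect to the first variable. -/
def dehom : MvPolynomial (Fin 3) K →ₐ[K] MvPolynomial (Fin 2) K :=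
  aeval ![1, X 0, X 1]

theorem chart_of_isHomogeneous {p : MvPolynomial (Fin 3) K} {n : ℕ} (hp : p.IsHomogeneous n) :
    chart p = Polynomial.C (dehom p) * Polynomial.X ^ n := by
  rw [chart, dehom, aeval_def, aeval_def, eval₂_eq', eval₂_eq', map_sum, Finset.sum_mul]
  refine Finset.sum_congr rfl fun d hd => ?_
  have hdeg : d 0 + d 1 + d 2 = n := by
    have := hp (mem_support_iff.mp hd)
    rw [Finsupp.weight_apply, Finsupp.sum_fintype _ _ (by simp)] at this
    simpa [Fin.sum_univ_three] using this
  simp only [Fin.prod_univ_three, Polynomial.algebraMap_apply, ← hdeg]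
  simp
  ring

theorem coeff_chart (p : MvPolynomial (Fin 3) K) (n : ℕ) :
    (chart p).coeff n = dehom (homogeneousComponent n p) := by
  conv_lhs => rw [← sum_homogeneousComponent p]
  rw [map_sum, Polynomial.finsetSum_coeff]
  simp_rw [chart_of_isHomogeneous (homogeneousComponent_isHomogeneous _ p),
    Polynomial.coeff_C_mul_X_pow]
  rw [Finset.sum_ite_eq]
  split_ifs with h
  · rfl
  · rw [homogeneousComponent_eq_zero _ _ (by simpa [Nat.lt_succ_iff] using h), map_zero]

theorem chart_injective [Infinite K] :
    Function.Injective (chart : MvPolynomial (Fin 3) K →ₐ[K] _) := by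
  rw [injective_iff_map_eq_zero]
  intro p hp
  -- The factor `X 0` disposes of the points with `v 0 = 0`; elsewhere $w, s, t$ can be recovered
  -- from `v`.
  have key : X 0 * p = 0 := by
    refine MvPolynomial.funext fun v => ?_
    by_cases h0 : v 0 = 0
    · simp [h0]
    have : Polynomial.eval₂RingHom (aeval ![v 1 / v 0, v 2 / v 0] :
        MvPolynomial (Fin 2) K →ₐ[K] K).toRingHom (v 0) (chart p) = eval v p := by
      clear hp
      induction p using MvPolynomial.induction_on with
      | C a => simp [Polynomial.algebraMap_apply, ← algebraMap_eq]
      | add p q hp hq => rw [map_add, map_add, map_add, hp, hq]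
      | mul_X p i hp =>
        rw [map_mul, map_mul, map_mul, hp, eval_X]
        congr 1
        fin_cases i <;> simp [chart] <;> field_simp
    rw [map_mul, ← this, hp, map_zero, mul_zero, map_zero]
  exact (mul_eq_zero.mp key).resolve_left (X_ne_zero 0)

theorem coeff_chart_eq_zero_iff [Infinite K] (p : MvPolynomial (Fin 3) K) (n : ℕ) :
    (chart p).coeff n = 0 ↔ homogeneousComponent n p = 0 := by
  rw [coeff_chart]
  refine ⟨fun h => chart_injective ?_, fun h => by rw [h, map_zero]⟩
  rw [chart_of_isHomogeneous (homogeneousComponent_isHomogeneous n p), h, map_zero, map_zero,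
    zero_mul]

theorem homogeneousComponent_totalDegree_ne_zero {σ : Type*} {p : MvPolynomial σ K} (hp : p ≠ 0) :
    homogeneousComponent p.totalDegree p ≠ 0 := by
  obtain ⟨d, hd, hdeg⟩ := Finset.exists_mem_eq_sup p.support (support_nonempty.mpr hp)
    (fun s => s.sum fun _ e => e)
  intro h
  have := congrArg (coeff d) h
  rw [coeff_homogeneousComponent, if_pos, coeff_zero] at this
  · exact (mem_support_iff.mp hd) this
  · rw [totalDegree, hdeg]; rfl

theorem natDegree_chart [Infinite K] {p : MvPolynomial (Fin 3) K} (hp : p ≠ 0) :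
    (chart p).natDegree = p.totalDegree := by
  refine Polynomial.natDegree_eq_of_le_of_coeff_ne_zero ?_
    ((coeff_chart_eq_zero_iff _ _).not.mpr (homogeneousComponent_totalDegree_ne_zero hp))
  refine Polynomial.natDegree_le_iff_coeff_eq_zero.mpr fun n hn => ?_
  rw [coeff_chart_eq_zero_iff, homogeneousComponent_eq_zero _ _ hn]

/-- The substitution splits off exactly the power of `w` given by the multiplicity of `p` at the
origin; the degree in `w` of the cofactor is the total degree minus that multiplicity. -/
theorem exists_chart_eq_X_pow_mul [Infinite K] {p : MvPolynomial (Fin 3) K} (hp : p ≠ 0) :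
    ∃ G : Polynomial (MvPolynomial (Fin 2) K),
      chart p = Polynomial.X ^ sInf {n | homogeneousComponent n p ≠ 0} * G ∧ G.coeff 0 ≠ 0 ∧
      p.totalDegree = sInf {n | homogeneousComponent n p ≠ 0} + G.natDegree := by
  set m := sInf {n | homogeneousComponent n p ≠ 0} with hm
  have hmem : homogeneousComponent m p ≠ 0 :=
    Nat.sInf_mem (s := {n | homogeneousComponent n p ≠ 0}) ⟨_, homogeneousComponent_totalDegree_ne_zero hp⟩
  obtain ⟨G, hG⟩ : Polynomial.X ^ m ∣ chart p := by
    rw [Polynomial.X_pow_dvd_iff]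
    intro d hd
    rw [coeff_chart_eq_zero_iff]
    by_contra h
    exact Nat.notMem_of_lt_sInf hd h
  have h0 : G.coeff 0 ≠ 0 := by
    rw [ne_eq, ← coeff_chart_eq_zero_iff, hG] at hmem
    simpa [Polynomial.coeff_X_pow_mul'] using hmem
  refine ⟨G, hG, h0, ?_⟩
  rw [← natDegree_chart hp, hG, Polynomial.natDegree_mul (by simp) (by rintro rfl; simp at h0),
    Polynomial.natDegree_X_pow]

/-- The substitution becomes surjective once $w$ is inverted, since $s = y/x$ and $t = z/x$. -/
theorem exists_chart_eq (P : Polynomial (MvPolynomial (Fin 2) K)) :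
    ∃ (n : ℕ) (p : MvPolynomial (Fin 3) K), chart p = Polynomial.X ^ n * P := by
  have hadd : ∀ P Q : Polynomial (MvPolynomial (Fin 2) K),
      (∃ (n : ℕ) (p : MvPolynomial (Fin 3) K), chart p = Polynomial.X ^ n * P) →
      (∃ (n : ℕ) (p : MvPolynomial (Fin 3) K), chart p = Polynomial.X ^ n * Q) →
      ∃ (n : ℕ) (p : MvPolynomial (Fin 3) K), chart p = Polynomial.X ^ n * (P + Q) := by
    rintro P Q ⟨n, p, hp⟩ ⟨k, q, hq⟩
    refine ⟨n + k, X 0 ^ k * p + X 0 ^ n * q, ?_⟩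
    rw [map_add, map_mul, map_mul, hp, hq]
    simp [chart]
    ring
  induction P using Polynomial.induction_on with
  | C a =>
    induction a using MvPolynomial.induction_on with
    | C a => exact ⟨0, C a, by simp [Polynomial.algebraMap_apply, ← algebraMap_eq]⟩
    | add p q hp hq => rw [Polynomial.C_add]; exact hadd _ _ hp hq
    | mul_X p i hp =>
      obtain ⟨n, p', h⟩ := hp
      refine ⟨n + 1, p' * X i.succ, ?_⟩
      rw [map_mul, h, Polynomial.C_mul]
      fin_cases i <;> simp [chart] <;> ring
  | add p q hp hq => exact hadd _ _ hp hq
  | monomial k a h =>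
    obtain ⟨n, p, h⟩ := h
    refine ⟨n, p * X 0, ?_⟩
    rw [map_mul, h]
    simp [chart]
    ring

/-! ### Projection of an affine surface from the origin -/

section Projection

variable {L : Type*} [Field L] [Algebra K L] (w : L) (φ : Fin 2 → L)

/-- Evaluation of `K[s, t][w]` at elements of a field. -/
def evalChart : Polynomial (MvPolynomial (Fin 2) K) →+* L :=
  Polynomial.eval₂RingHom (aeval φ : MvPolynomial (Fin 2) K →ₐ[K] L).toRingHom w

theorem evalChart_chart (p : MvPolynomial (Fin 3) K) :
    evalChart w φ (chart p) = aeval ![w, w * φ 0, w * φ 1] p := by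
  induction p using MvPolynomial.induction_on with
  | C a => simp [evalChart, Polynomial.algebraMap_apply, ← algebraMap_eq]
  | add p q hp hq => rw [map_add, map_add, map_add, hp, hq]
  | mul_X p i hp =>
    rw [map_mul, map_mul, map_mul, hp]
    congr 1
    fin_cases i <;> simp [chart, evalChart, mul_comm (φ _)]

variable {w φ} {F : MvPolynomial (Fin 3) K} {G : Polynomial (MvPolynomial (Fin 2) K)} {m : ℕ}

/-- A power of $w$ brings `P` into the image of `chart`, where `hF` applies; the power is then
cancelled because the prime $w$ does not divide `G`. -/
theorem evalChart_eq_zero_iff (hw : w ≠ 0)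
    (hF : ∀ p : MvPolynomial (Fin 3) K, aeval ![w, w * φ 0, w * φ 1] p = 0 ↔ F ∣ p)
    (hG : chart F = Polynomial.X ^ m * G) (hG0 : G.coeff 0 ≠ 0)
    (P : Polynomial (MvPolynomial (Fin 2) K)) : evalChart w φ P = 0 ↔ G ∣ P := by
  have hX : evalChart w φ (Polynomial.X : Polynomial (MvPolynomial (Fin 2) K)) = w := by
    simp [evalChart]
  constructor
  · intro h
    obtain ⟨n, p, hp⟩ := exists_chart_eq P
    obtain ⟨q, rfl⟩ : F ∣ p := by
      rw [← hF, ← evalChart_chart, hp, map_mul, h, mul_zero]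
    have hdvd : G ∣ Polynomial.X ^ n * P :=
      ⟨Polynomial.X ^ m * chart q, by rw [← hp, map_mul, hG]; ring⟩
    have hrel : ∀ n, ∀ P : Polynomial (MvPolynomial (Fin 2) K),
        G ∣ Polynomial.X ^ n * P → G ∣ P := by
      intro n
      induction n with
      | zero => simp
      | succ n ih =>
        rintro P ⟨Q, hQ⟩
        have : Polynomial.X ∣ G * Q := ⟨Polynomial.X ^ n * P, by rw [← hQ]; ring⟩
        obtain ⟨Q', rfl⟩ := (Polynomial.prime_X.dvd_or_dvd this).resolve_left
          (by rwa [Polynomial.X_dvd_iff])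
        refine ih P ⟨Q', mul_left_cancel₀ Polynomial.X_ne_zero ?_⟩
        rw [← mul_assoc, ← pow_succ', hQ]; ring
    exact hrel n P hdvd
  · rintro ⟨Q, rfl⟩
    have h1 : evalChart w φ (chart F) = 0 := by rw [evalChart_chart, hF]
    rw [hG, map_mul, map_pow, hX] at h1
    rw [map_mul, (mul_eq_zero.mp h1).resolve_left (pow_ne_zero _ hw), zero_mul]

/-- A relation among the `φ i` alone has degree $0$ in $w$, too small for a nonzero multiple of `G`.
-/
theorem algebraicIndependent_of_natDegree_pos
    (hker : ∀ P : Polynomial (MvPolynomial (Fin 2) K), evalChart w φ P = 0 ↔ G ∣ P)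
    (hdeg : 0 < G.natDegree) : AlgebraicIndependent K φ := by
  rw [algebraicIndependent_iff]
  intro q hq
  by_contra hq0
  have : G ∣ Polynomial.C q := by rw [← hker]; simpa [evalChart] using hq
  have := Polynomial.natDegree_le_of_dvd this (by simpa using hq0)
  rw [Polynomial.natDegree_C] at this
  omega

end Projection

section Projection

variable {L : Type*} [Field L] [Algebra K L] {w : L} {φ : Fin 2 → L}
  {G : Polynomial (MvPolynomial (Fin 2) K)}

open IntermediateField in
-- `G` generates the kernel of a map to a field, so it is prime; by Gauss's lemma it stays
-- irreducible over $K(s,t) \cong K(\varphi)$.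
theorem finrank_adjoin_of_natDegree_pos
    (hker : ∀ P : Polynomial (MvPolynomial (Fin 2) K), evalChart w φ P = 0 ↔ G ∣ P)
    (hG : G ≠ 0) (hdeg : 0 < G.natDegree) :
    Module.finrank (adjoin K (Set.range φ)) (adjoin K (Set.range φ))⟮w⟯ = G.natDegree := by
  have hφ := algebraicIndependent_of_natDegree_pos hker hdeg
  have hprime : Prime G := by
    rw [← Ideal.span_singleton_prime hG]
    have : Ideal.span {G} = RingHom.ker (evalChart w φ) := by
      ext P
      rw [Ideal.mem_span_singleton, RingHom.mem_ker, hker]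
    rw [this]
    exact RingHom.ker_isPrime _
  have hirr := ((hprime.irreducible.isPrimitive hdeg.ne').irreducible_iff_irreducible_map_fraction_map
    (K := FractionRing (MvPolynomial (Fin 2) K))).mp hprime.irreducible
  have hirr' := (MulEquiv.irreducible_iff
    (Polynomial.mapEquiv hφ.aevalEquivField.toRingEquiv)).mpr hirr
  rw [Polynomial.mapEquiv_apply, Polynomial.map_map] at hirr'
  have hroot : Polynomial.aeval w (G.map ((hφ.aevalEquivField : FractionRing (MvPolynomial (Fin 2) K) →+* adjoin K (Set.range φ)).comp
      (algebraMap (MvPolynomial (Fin 2) K) _))) = 0 := by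
    have hcomp : (algebraMap (adjoin K (Set.range φ)) L).comp
        ((hφ.aevalEquivField : FractionRing (MvPolynomial (Fin 2) K) →+* adjoin K (Set.range φ)).comp
          (algebraMap (MvPolynomial (Fin 2) K) _)) =
        (aeval φ : MvPolynomial (Fin 2) K →ₐ[K] L).toRingHom :=
      RingHom.ext fun a => hφ.aevalEquivField_algebraMap_apply_coe a
    rw [Polynomial.aeval_def, Polynomial.eval₂_map, hcomp]
    exact (hker G).mpr dvd_rfl
  have hint : IsIntegral (adjoin K (Set.range φ)) w :=
    IsAlgebraic.isIntegral ⟨_, hirr'.ne_zero, hroot⟩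
  rw [adjoin.finrank hint, ← minpoly.eq_of_irreducible hirr' hroot, Polynomial.natDegree_mul_C
    (inv_ne_zero (Polynomial.leadingCoeff_ne_zero.mpr hirr'.ne_zero))]
  exact Polynomial.natDegree_map_eq_of_injective
    (hφ.aevalEquivField.injective.comp (IsFractionRing.injective _ _)) _

variable (w φ) in
theorem exists_evalChart_eq_zero (hw : IsAlgebraic (Algebra.adjoin K (Set.range φ)) w) :
    ∃ P : Polynomial (MvPolynomial (Fin 2) K), evalChart w φ P = 0 ∧
      P.map (aeval φ : MvPolynomial (Fin 2) K →ₐ[K] L).toRingHom ≠ 0 := by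
  obtain ⟨P, hP0, hP⟩ := hw
  let g : MvPolynomial (Fin 2) K →+* Algebra.adjoin K (Set.range φ) :=
    ((aeval φ : MvPolynomial (Fin 2) K →ₐ[K] L).codRestrict _ fun p => by
      rw [Algebra.adjoin_range_eq_range_aeval]; exact ⟨p, rfl⟩).toRingHom
  have hsurj : Function.Surjective g := by
    rintro ⟨y, hy⟩
    obtain ⟨p, rfl⟩ := (Algebra.adjoin_range_eq_range_aeval K φ) ▸ hy
    exact ⟨p, Subtype.ext rfl⟩
  have hg : (algebraMap (Algebra.adjoin K (Set.range φ)) L).comp g =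
    (aeval φ : MvPolynomial (Fin 2) K →ₐ[K] L).toRingHom := rfl
  obtain ⟨Q, rfl⟩ := Polynomial.map_surjective g hsurj P
  refine ⟨Q, ?_, ?_⟩
  · rw [← hP, Polynomial.aeval_def, Polynomial.eval₂_map]
    rfl
  · rw [← hg, ← Polynomial.map_map]
    exact (Polynomial.map_ne_zero_iff Subtype.val_injective).mpr hP0

open IntermediateField in
-- Here `G` is a relation among the `φ i`. Every equation for `w` over $K[\varphi]$ lifts to a
-- multiple of `G`, hence is trivial: `w` is transcendental and `finrank` takes its default value
-- $0$.
theorem finrank_adjoin_of_natDegree_eq_zero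
    (hker : ∀ P : Polynomial (MvPolynomial (Fin 2) K), evalChart w φ P = 0 ↔ G ∣ P)
    (hdeg : G.natDegree = 0) :
    Module.finrank (adjoin K (Set.range φ)) (adjoin K (Set.range φ))⟮w⟯ = 0 := by
  obtain ⟨g, rfl⟩ := Polynomial.natDegree_eq_zero.mp hdeg
  have hg : aeval φ g = 0 := by simpa [evalChart] using (hker (Polynomial.C g)).mpr dvd_rfl
  refine Module.finrank_of_not_finite fun hfin => ?_
  have hw : IsAlgebraic (adjoin K (Set.range φ)) w := by
    have := Algebra.IsAlgebraic.isAlgebraic (R := adjoin K (Set.range φ))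
      (AdjoinSimple.gen (adjoin K (Set.range φ)) w)
    simpa using this.algebraMap (A := L)
  have hw' : IsAlgebraic (Algebra.adjoin K (Set.range φ)) w :=
    (IsFractionRing.isAlgebraic_iff _ (adjoin K (Set.range φ)) L).mpr hw
  obtain ⟨P, hP, hP0⟩ := exists_evalChart_eq_zero w φ hw'
  obtain ⟨Q, rfl⟩ := (hker P).mp hP
  apply hP0
  rw [Polynomial.map_mul, Polynomial.map_C]
  simp [hg]

open IntermediateField in
theorem finrank_adjoin_eq_natDegree
    (hker : ∀ P : Polynomial (MvPolynomial (Fin 2) K), evalChart w φ P = 0 ↔ G ∣ P)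
    (hG : G ≠ 0) :
    Module.finrank (adjoin K (Set.range φ)) (adjoin K (Set.range φ))⟮w⟯ = G.natDegree := by
  rcases Nat.eq_zero_or_pos G.natDegree with h | h
  · rw [finrank_adjoin_of_natDegree_eq_zero hker h, h]
  · exact finrank_adjoin_of_natDegree_pos hker hG h

end Projection

/-! ### Transcendence degree of fields generated by two elements -/

section Trdeg

variable {F : Type u} [Field F] {B E : Type u} [CommRing B] [IsDomain B] [Algebra F B]
  [Field E] [Algebra F E] [Algebra B E] [IsScalarTower F B E] [IsFractionRing B E]

variable (E) in
theorem trdeg_le_two_of_surjective (g : MvPolynomial (Fin 2) F →ₐ[F] B)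
    (hg : Function.Surjective g) : Algebra.trdeg F E ≤ 2 := by
  have h1 := trdeg_le_of_surjective g hg
  rw [MvPolynomial.trdeg_of_isDomain] at h1
  have h2 := trdeg_add_eq F B (A := E)
  have : Algebra.IsAlgebraic B E := (IsFractionRing.comap_isAlgebraic_iff (K := E)).mpr inferInstance
  rw [trdeg_eq_zero (R := B), add_zero] at h2
  rw [← h2]
  simpa using h1

theorem isAlgebraic_adjoin_of_trdeg_le_two (h : Algebra.trdeg F E ≤ 2) {φ : Fin 2 → E}
    (hφ : AlgebraicIndependent F φ) : Algebra.IsAlgebraic (Algebra.adjoin F (Set.range φ)) E :=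
  (hφ.isTranscendenceBasis_of_lift_trdeg_le_of_finite (by simpa using h)).isAlgebraic

end Trdeg

theorem ratMapDegree_pos {φ : Fin 2 → RatFun K} (hφ : AlgebraicIndependent K φ) :
    0 < ratMapDegree φ := by
  have h := trdeg_le_two_of_surjective (RatFun K) (AlgHom.id K (MvPolynomial (Fin 2) K))
    Function.surjective_id
  have := isAlgebraic_adjoin_of_trdeg_le_two h hφ
  have : Algebra.IsAlgebraic (IntermediateField.adjoin K (Set.range φ)) (RatFun K) :=
    (IsFractionRing.comap_isAlgebraic_iff (A := Algebra.adjoin K (Set.range φ))).mp this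
  have : Algebra.EssFiniteType (MvPolynomial (Fin 2) K) (RatFun K) :=
    .of_isLocalization _ (nonZeroDivisors _)
  have : Algebra.EssFiniteType K (RatFun K) := .comp K (MvPolynomial (Fin 2) K) _
  have : Algebra.EssFiniteType (IntermediateField.adjoin K (Set.range φ)) (RatFun K) :=
    .of_comp K _ _
  have : FiniteDimensional (IntermediateField.adjoin K (Set.range φ)) (RatFun K) := by
    exact Algebra.finite_of_essFiniteType_of_isAlgebraic
  exact Module.finrank_pos

/-! ### The gcd polynomial of a dominant map is trivial -/

/-- Specializing $h$ at any point of $K^2$ turns `p` into a common divisor of `n` and `d`, a unit;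
so every nonconstant coefficient of `p` vanishes at every $h$. -/
theorem totalDegree_eq_zero_of_dvd_map_C [Infinite K] {n d : MvPolynomial (Fin 2) K}
    (hnd : IsRelPrime n d) {p : DoublePoly K} (hn : p ∣ MvPolynomial.map C n)
    (hd : p ∣ MvPolynomial.map C d) : p.totalDegree = 0 := by
  have hspec : ∀ (h : Fin 2 → K) (q : MvPolynomial (Fin 2) K),
      MvPolynomial.map (eval h) (MvPolynomial.map C q : DoublePoly K) = q := by
    intro h q
    rw [MvPolynomial.map_map]
    have : (eval h).comp (C : K →+* MvPolynomial (Fin 2) K) = RingHom.id K := by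
      ext a
      simp
    rw [this, MvPolynomial.map_id]
  rw [totalDegree_eq_zero_iff_eq_C]
  ext1 e
  rw [coeff_C]
  split_ifs with he
  · rw [he]
  refine MvPolynomial.funext fun h => ?_
  have hu : IsUnit (MvPolynomial.map (eval h) p) :=
    hnd (by simpa only [hspec] using map_dvd (MvPolynomial.map (eval h)) hn)
      (by simpa only [hspec] using map_dvd (MvPolynomial.map (eval h)) hd)
  obtain ⟨r, -, hr⟩ := isUnit_iff_eq_C_of_isReduced.mp hu
  rw [map_zero, ← coeff_map, hr, coeff_C, if_neg he]

theorem not_dvd_C {p : DoublePoly K} (hp : 0 < p.totalDegree) {q : MvPolynomial (Fin 2) K}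
    (hq : q ≠ 0) : ¬ p ∣ C q := by
  rintro ⟨r, hr⟩
  have hr0 : p * r ≠ 0 := by rw [← hr]; simpa using hq
  have := congrArg totalDegree hr
  rw [totalDegree_C, totalDegree_mul_of_isDomain (left_ne_zero_of_mul hr0)
    (right_ne_zero_of_mul hr0)] at this
  omega

theorem dvd_of_dvd_diffNumer {n d : MvPolynomial (Fin 2) K} (hd : d ≠ 0) {p : DoublePoly K}
    (hp : Irreducible p) (h : p ∣ diffNumer (toRat n / toRat d)) :
    p ∣ MvPolynomial.map C n * C d - C n * MvPolynomial.map C d := by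
  set χ := toRat n / toRat d with hχ
  set den : DoublePoly K := (IsFractionRing.den (DoublePoly K) (inTS χ - inH χ)).1 with hden
  have hmap : (MvPolynomial.map C d : DoublePoly K) ≠ 0 :=
    (map_ne_zero_iff _ (MvPolynomial.map_injective _ (C_injective _ _))).mpr hd
  have hC : (C d : DoublePoly K) ≠ 0 := by simpa using hd
  have inj := IsFractionRing.injective (DoublePoly K) (FractionRing (DoublePoly K))
  have hmap' := (map_ne_zero_iff _ inj).mpr hmap
  have hC' := (map_ne_zero_iff _ inj).mpr hC
  have hden' : algebraMap (DoublePoly K) (FractionRing (DoublePoly K)) den ≠ 0 :=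
    (map_ne_zero_iff _ inj).mpr (nonZeroDivisors.coe_ne_zero _)
  have h1 : algebraMap _ _ (diffNumer χ) / algebraMap _ _ den = inTS χ - inH χ :=
    IsFractionRing.mk'_num_den' (DoublePoly K) _
  have hTS : inTS χ = algebraMap _ _ (MvPolynomial.map C n : DoublePoly K) /
      algebraMap _ _ (MvPolynomial.map C d : DoublePoly K) := by
    rw [hχ, inTS, map_div₀, IsFractionRing.lift_algebraMap, IsFractionRing.lift_algebraMap]
    rfl
  have hH : inH χ = algebraMap _ _ (C n : DoublePoly K) / algebraMap _ _ (C d : DoublePoly K) := by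
    rw [hχ, inH, map_div₀, IsFractionRing.lift_algebraMap, IsFractionRing.lift_algebraMap]
    rfl
  rw [hTS, hH] at h1
  have h2 : (MvPolynomial.map C n * C d - C n * MvPolynomial.map C d) * den =
      diffNumer χ * (MvPolynomial.map C d * C d) := by
    apply inj
    simp only [map_mul, map_sub]
    field_simp at h1
    linear_combination -h1
  have h3 : p ∣ (MvPolynomial.map C n * C d - C n * MvPolynomial.map C d) * den := by
    rw [h2]; exact h.mul_right _
  refine (hp.prime.dvd_or_dvd h3).resolve_right fun h4 => hp.not_isUnit ?_
  exact IsFractionRing.num_den_reduced (DoublePoly K) (inTS χ - inH χ) h h4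

theorem degreeOf_toMvPolynomial_of_ne {R σ : Type*} [CommRing R] {i j : σ} (hij : i ≠ j)
    (q : Polynomial R) : (q.toMvPolynomial j).degreeOf i = 0 := by
  classical
  by_contra h
  rw [← ne_eq, ← mem_vars_iff_degreeOf_ne_zero, Polynomial.toMvPolynomial_eq_rename_comp] at h
  obtain ⟨k, -, hk⟩ := mem_vars_rename _ _ h
  exact hij hk.symm

theorem totalDegree_eq_zero_of_dvd_toMvPolynomial {R : Type*} [CommRing R] [IsDomain R]
    {p : MvPolynomial (Fin 2) R}
    (h : ∀ j, ∃ q : Polynomial R, q ≠ 0 ∧ p ∣ q.toMvPolynomial j) : p.totalDegree = 0 := by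
  have hdeg : ∀ i j : Fin 2, i ≠ j → p.degreeOf i = 0 := by
    intro i j hij
    obtain ⟨q, hq, r, hr⟩ := h j
    have hq' : q.toMvPolynomial j ≠ 0 :=
      (map_ne_zero_iff _ (Polynomial.toMvPolynomial_injective j)).mpr hq
    rw [hr] at hq'
    have := degreeOf_toMvPolynomial_of_ne hij q
    rw [hr, degreeOf_mul_eq (left_ne_zero_of_mul hq') (right_ne_zero_of_mul hq')] at this
    omega
  rw [totalDegree_eq_zero_iff_eq_C, ← vars_eq_empty_iff_eq_C, Finset.eq_empty_iff_forall_notMem]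
  intro i hi
  rw [mem_vars_iff_degreeOf_ne_zero] at hi
  fin_cases i
  · exact hi (hdeg 0 1 (by decide))
  · exact hi (hdeg 1 0 (by decide))

/-- The field $T$ generated by the images of $t, s$ has transcendence degree at most $2$ and
contains the independent pair $\chi(t,s) = \chi(h)$. So it is algebraic over $K(\chi(h)) \subseteq
K(h)$. -/
theorem exists_eval₂_eq_zero_of_algebraicIndependent {L : Type u} [Field L] [Algebra K L]
    {n d : Fin 2 → MvPolynomial (Fin 2) K}
    (hχ : AlgebraicIndependent K fun i => toRat (n i) / toRat (d i))
    (hb tb : MvPolynomial (Fin 2) K →ₐ[K] L) (hinj : Function.Injective hb)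
    (hd : ∀ i, d i ≠ 0) (htd : ∀ i, tb (d i) ≠ 0)
    (heq : ∀ i, tb (n i) * hb (d i) = hb (n i) * tb (d i)) (j : Fin 2) :
    ∃ q : Polynomial (MvPolynomial (Fin 2) K), q ≠ 0 ∧ q.eval₂ (hb : _ →+* L) (tb (X j)) = 0 := by
  let η : RatFun K →ₐ[K] L := IsFractionRing.liftAlgHom hinj
  have hη : ∀ p, η (toRat p) = hb p := fun p => IsFractionRing.lift_algebraMap hinj p
  let t : Fin 2 → L := fun j => tb (X j)
  let T := IntermediateField.adjoin K (Set.range t)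
  have htb : tb = aeval t := by ext; simp [t]
  have hmem : ∀ p, tb p ∈ T := fun p => by
    rw [htb]
    refine IntermediateField.algebra_adjoin_le_adjoin K _ ?_
    rw [Algebra.adjoin_range_eq_range_aeval]
    exact ⟨p, rfl⟩
  have hξ : ∀ i, η (toRat (n i) / toRat (d i)) = tb (n i) / tb (d i) := fun i => by
    rw [map_div₀, hη, hη, div_eq_div_iff _ (htd i), heq]
    exact (map_ne_zero_iff _ hinj).mpr (hd i)
  let ξ : Fin 2 → T := fun i => ⟨tb (n i) / tb (d i), div_mem (hmem _) (hmem _)⟩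
  have hξη : ∀ i, (ξ i : L) = η (toRat (n i) / toRat (d i)) := fun i => (hξ i).symm
  have hind : AlgebraicIndependent K ξ := by
    refine AlgebraicIndependent.of_comp T.val ?_
    have := hχ.map' (f := η) η.injective
    convert this using 1
    ext i
    exact hξη i
  let g : MvPolynomial (Fin 2) K →ₐ[K] Algebra.adjoin K (Set.range t) :=
    (aeval t : MvPolynomial (Fin 2) K →ₐ[K] L).codRestrict _ fun p => by
      rw [Algebra.adjoin_range_eq_range_aeval]; exact ⟨p, rfl⟩
  have hg : Function.Surjective g := by
    rintro ⟨y, hy⟩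
    obtain ⟨p, rfl⟩ := (Algebra.adjoin_range_eq_range_aeval K t) ▸ hy
    exact ⟨p, Subtype.ext rfl⟩
  have halg := isAlgebraic_adjoin_of_trdeg_le_two (trdeg_le_two_of_surjective T g hg) hind
  have htT : t j ∈ T := IntermediateField.subset_adjoin K _ ⟨j, rfl⟩
  obtain ⟨P, hP, hP0⟩ := exists_evalChart_eq_zero (⟨t j, htT⟩ : T) ξ (halg.isAlgebraic _)
  have hP0' : P ≠ 0 := by rintro rfl; simp at hP0
  algebraize [η.toRingHom]
  algebraize [hb.toRingHom]
  have : IsScalarTower (MvPolynomial (Fin 2) K) (RatFun K) L :=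
    IsScalarTower.of_algebraMap_eq fun p => (hη p).symm
  have hchi := algebraicIndependent_iff_injective_aeval.mp hχ
  -- Independence of $\chi$ keeps the equation nonzero when its coefficients are read in $K(h)$.
  have hRat : IsAlgebraic (RatFun K) (t j) := by
    refine ⟨P.map (aeval fun i => toRat (n i) / toRat (d i) :
      MvPolynomial (Fin 2) K →ₐ[K] RatFun K).toRingHom,
      (Polynomial.map_ne_zero_iff hchi).mpr hP0', ?_⟩
    have h0 := congrArg (algebraMap T L) hP
    rw [evalChart, Polynomial.coe_eval₂RingHom, Polynomial.hom_eval₂, map_zero] at h0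
    rw [Polynomial.aeval_def, Polynomial.eval₂_map, ← h0]
    congr 1
    ext i
    · simp [RingHom.algebraMap_toAlgebra]
    · simpa [RingHom.algebraMap_toAlgebra] using (hξη i).symm
  obtain ⟨q, hq, hq0⟩ := (IsFractionRing.isAlgebraic_iff (MvPolynomial (Fin 2) K) (RatFun K) L).mpr
    hRat
  exact ⟨q, hq, hq0⟩

/-- In the function field `L` of the hypersurface $p = 0$ one has $\chi(t,s) = \chi(h)$, so $t$ and
$s$ are each algebraic over $K(h)$. Thus `p` divides a nonzero polynomial in $t$ alone and one in
$s$ alone, and involves neither. -/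
theorem totalDegree_eq_zero_of_dvd_diffNumer [Infinite K] {χ : Fin 2 → RatFun K}
    (hχ : AlgebraicIndependent K χ) {p : DoublePoly K} (hp : Irreducible p)
    (h : ∀ i, p ∣ diffNumer (χ i)) : p.totalDegree = 0 := by
  by_contra hdeg
  have hdeg : 0 < p.totalDegree := Nat.pos_of_ne_zero hdeg
  have hred : ∀ i, ∃ n d : MvPolynomial (Fin 2) K, d ≠ 0 ∧ IsRelPrime n d ∧
      χ i = toRat n / toRat d := fun i =>
    ⟨IsFractionRing.num _ (χ i), (IsFractionRing.den _ (χ i)).1, nonZeroDivisors.coe_ne_zero _,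
      IsFractionRing.num_den_reduced _ _, (IsFractionRing.mk'_num_den' _ _).symm⟩
  choose n d hd hnd hχnd using hred
  obtain rfl : χ = fun i => toRat (n i) / toRat (d i) := funext hχnd
  have hcross := fun i => dvd_of_dvd_diffNumer (hd i) hp (h i)
  have hprime : (Ideal.span {p}).IsPrime :=
    (Ideal.span_singleton_prime hp.ne_zero).mpr hp.prime
  let B := DoublePoly K ⧸ Ideal.span {p}
  let L := FractionRing B
  let π : DoublePoly K →ₐ[K] L :=
    (IsScalarTower.toAlgHom K B L).comp (Ideal.Quotient.mkₐ K (Ideal.span {p}))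
  have hπ : ∀ q, π q = 0 ↔ p ∣ q := fun q => by
    rw [← Ideal.mem_span_singleton, ← Ideal.Quotient.eq_zero_iff_mem]
    exact map_eq_zero_iff _ (IsFractionRing.injective B L)
  let hb : MvPolynomial (Fin 2) K →ₐ[K] L :=
    π.comp (IsScalarTower.toAlgHom K (MvPolynomial (Fin 2) K) (DoublePoly K))
  let tb : MvPolynomial (Fin 2) K →ₐ[K] L :=
    π.comp (MvPolynomial.mapAlgHom (Algebra.ofId K (MvPolynomial (Fin 2) K)))
  have hhb : ∀ q, hb q = π (C q) := fun q => rfl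
  have htb : ∀ q, tb q = π (MvPolynomial.map C q) := fun q => rfl
  have hinj : Function.Injective hb := by
    rw [injective_iff_map_eq_zero]
    intro q hq
    by_contra hq0
    exact not_dvd_C hdeg hq0 ((hπ _).mp hq)
  -- If `p` divided $d_i(t,s)$, the cross relation would make it divide $n_i(t,s)$ as well, against
  -- coprimality.
  have htd : ∀ i, tb (d i) ≠ 0 := by
    intro i h0
    rw [htb, hπ] at h0
    have h1 : p ∣ MvPolynomial.map C (n i) * C (d i) := by
      have := (hcross i).add (h0.mul_left (C (n i)))
      simpa using this
    have h2 := (hp.prime.dvd_or_dvd h1).resolve_right (not_dvd_C hdeg (hd i))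
    exact hdeg.ne' (totalDegree_eq_zero_of_dvd_map_C (hnd i) h2 h0)
  have heq : ∀ i, tb (n i) * hb (d i) = hb (n i) * tb (d i) := by
    intro i
    rw [hhb, hhb, htb, htb, ← map_mul, ← map_mul, ← sub_eq_zero, ← map_sub, hπ]
    exact hcross i
  refine hdeg.ne' (totalDegree_eq_zero_of_dvd_toMvPolynomial fun j => ?_)
  obtain ⟨q, hq, hq0⟩ :=
    exists_eval₂_eq_zero_of_algebraicIndependent hχ hb tb hinj hd htd heq j
  refine ⟨q, hq, ?_⟩
  rw [← hπ, ← hq0, Polynomial.toMvPolynomial, Polynomial.aeval_def, ← AlgHom.coe_toRingHom,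
    Polynomial.hom_eval₂, AlgHom.coe_toRingHom, htb, map_X]
  rfl

theorem gPoly_eq_one_of_algebraicIndependent [Infinite K] {N D : Fin 3 → MvPolynomial (Fin 2) K}
    {A : Fin 3 → K} (h : AlgebraicIndependent K (Phi N D A)) : gPoly N D A = 1 := by
  refine if_neg fun hpos => ?_
  set g := doubleGcd (diffNumer (Phi N D A 0)) (diffNumer (Phi N D A 1)) with hg
  let _ := UniqueFactorizationMonoid.toGCDMonoid (DoublePoly K)
  have h0 : g ∣ diffNumer (Phi N D A 0) := gcd_dvd_left _ _
  have h1 : g ∣ diffNumer (Phi N D A 1) := gcd_dvd_right _ _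
  clear_value g
  have hg0 : g ≠ 0 := by rintro rfl; simp at hpos
  -- The gcd may be reducible; total degree is additive over its irreducible factors.
  have key : ∀ a : DoublePoly K, a ≠ 0 → (∀ i, a ∣ diffNumer (Phi N D A i)) →
      a.totalDegree = 0 := by
    intro a
    induction a using WfDvdMonoid.induction_on_irreducible with
    | zero => simp
    | unit u hu =>
      intro _ _
      exact (isUnit_iff_totalDegree_of_isReduced.mp hu).2
    | mul a p ha hp ih =>
      intro _ hdvd
      rw [totalDegree_mul_of_isDomain hp.ne_zero ha,
        totalDegree_eq_zero_of_dvd_diffNumer h hp fun i => (dvd_mul_right _ _).trans (hdvd i),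
        ih ha fun i => (dvd_mul_left _ _).trans (hdvd i)]
  refine hpos.ne' (key g hg0 fun i => ?_)
  fin_cases i
  · exact h0
  · exact h1

/-! ### Translations -/

theorem eval_translate (A u : Fin 3 → K) (f : MvPolynomial (Fin 3) K) :
    eval u (translate A f) = eval (fun i => u i + A i) f := by
  rw [translate, aeval_def, ← coe_eval₂Hom, ← RingHom.comp_apply]
  congr 1
  ext <;> simp

theorem translate_neg_translate (A : Fin 3 → K) (f : MvPolynomial (Fin 3) K) :
    translate (-A) (translate A f) = f := by
  induction f using MvPolynomial.induction_on with
  | C a => simp [translate]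
  | add p q hp hq => rw [translate, translate, map_add, map_add] at *; rw [hp, hq]
  | mul_X p i hp =>
    rw [translate, translate, map_mul, map_mul] at *
    rw [hp]
    simp

theorem totalDegree_translate_le (A : Fin 3 → K) (f : MvPolynomial (Fin 3) K) :
    (translate A f).totalDegree ≤ f.totalDegree := by
  rw [translate, aeval_def, eval₂_eq']
  refine totalDegree_finsetSum_le fun d hd => ?_
  refine (totalDegree_mul _ _).trans ?_
  rw [algebraMap_eq, totalDegree_C, zero_add]
  refine (totalDegree_finsetProd _ _).trans (le_trans ?_ (le_totalDegree hd))
  rw [Finsupp.sum_fintype _ _ (by simp)]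
  refine Finset.sum_le_sum fun i _ => (totalDegree_pow _ _).trans ?_
  have : (X i + C (A i) : MvPolynomial (Fin 3) K).totalDegree ≤ 1 :=
    (totalDegree_add _ _).trans (by simp)
  nlinarith

theorem totalDegree_translate (A : Fin 3 → K) (f : MvPolynomial (Fin 3) K) :
    (translate A f).totalDegree = f.totalDegree := by
  refine le_antisymm (totalDegree_translate_le A f) ?_
  conv_lhs => rw [← translate_neg_translate A f]
  exact totalDegree_translate_le _ _

theorem translate_dvd_iff (A : Fin 3 → K) (f p : MvPolynomial (Fin 3) K) :
    translate A f ∣ p ↔ f ∣ translate (-A) p := by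
  constructor
  · rintro ⟨q, rfl⟩
    have : translate (-A) (translate A f * q) = translate (-A) (translate A f) * translate (-A) q :=
      map_mul _ _ _
    rw [this, translate_neg_translate]
    exact dvd_mul_right _ _
  · rintro ⟨q, hq⟩
    refine ⟨translate A q, ?_⟩
    have h1 := translate_neg_translate (-A) p
    rw [neg_neg, hq] at h1
    rw [← h1]
    exact map_mul _ _ _

theorem aeval_translate {L : Type*} [CommRing L] [Algebra K L] (A : Fin 3 → K) (v : Fin 3 → L)
    (f : MvPolynomial (Fin 3) K) :
    aeval v (translate A f) = aeval (fun i => v i + algebraMap K L (A i)) f := by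
  rw [translate, ← AlgHom.comp_apply]
  congr 1
  ext i
  simp

theorem multiplicityAt_eq_zero {f : MvPolynomial (Fin 3) K} {A : Fin 3 → K} (h : eval A f ≠ 0) :
    multiplicityAt f A = 0 := by
  refine Nat.sInf_eq_zero.mpr (Or.inl ?_)
  intro h0
  have h1 := eval_translate A 0 f
  simp only [Pi.zero_apply, zero_add] at h1
  rw [homogeneousComponent_zero, C_eq_zero, ← constantCoeff_eq, ← eval_zero, h1] at h0
  exact h h0

/-! ### The relations between the components of a parametrization -/

section Relations

variable {N D : Fin 3 → MvPolynomial (Fin 2) K}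

/-- The same `P` serves the generic point and every parameter value, linking relations between
rational functions to vanishing on the image. -/
theorem exists_clear_denominators (hD : ∀ i, D i ≠ 0) (p : MvPolynomial (Fin 3) K) :
    ∃ (n : ℕ) (P : MvPolynomial (Fin 2) K),
      aeval (paramFun N D) p * toRat (∏ i, D i) ^ n = toRat P ∧
      ∀ u : Fin 2 → K, (∀ i, eval u (D i) ≠ 0) →
        eval (fun i => eval u (N i) / eval u (D i)) p * eval u (∏ i, D i) ^ n = eval u P := by
  induction p using MvPolynomial.induction_on with
  | C a =>
    refine ⟨0, C a, ?_, fun u _ => by simp⟩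
    rw [pow_zero, mul_one, aeval_C]
    rfl
  | add p q hp hq =>
    obtain ⟨n, P, h1, h2⟩ := hp
    obtain ⟨k, Q, h3, h4⟩ := hq
    refine ⟨n + k, P * (∏ i, D i) ^ k + Q * (∏ i, D i) ^ n, ?_, fun u hu => ?_⟩
    · simp only [toRat] at h1 h3 ⊢
      rw [map_add, map_add, map_mul, map_mul, map_pow, map_pow, ← h1, ← h3]
      ring
    · rw [map_add, map_add, map_mul, map_mul, map_pow, map_pow, ← h2 u hu, ← h4 u hu]
      ring
  | mul_X p i hp =>
    obtain ⟨n, P, h1, h2⟩ := hp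
    refine ⟨n + 1, P * (N i * ∏ j ∈ Finset.univ.erase i, D j), ?_, fun u hu => ?_⟩
    · have hDi : toRat (D i) ≠ 0 := by simpa using hD i
      simp only [toRat] at h1 hDi ⊢
      rw [map_mul, aeval_X, map_mul, map_mul, ← h1, paramFun,
        ← Finset.mul_prod_erase _ D (Finset.mem_univ i), map_mul]
      field_simp
      ring
    · rw [map_mul, eval_X, map_mul, map_mul, ← h2 u hu,
        ← Finset.mul_prod_erase _ D (Finset.mem_univ i), map_mul]
      have := hu i
      field_simp
      ring

theorem aeval_paramFun_eq_zero_iff [Infinite K] (hD : ∀ i, D i ≠ 0) (p : MvPolynomial (Fin 3) K) :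
    aeval (paramFun N D) p = 0 ↔ p ∈ vanishingIdeal K (paramImage N D) := by
  obtain ⟨n, P, h1, h2⟩ := exists_clear_denominators (N := N) hD p
  have hprod : (∏ i, D i) ≠ 0 := Finset.prod_ne_zero_iff.mpr fun i _ => hD i
  have hprod' : toRat (∏ i, D i) ≠ 0 := by
    rwa [toRat, map_ne_zero_iff _ (IsFractionRing.injective _ _)]
  have hP : aeval (paramFun N D) p = 0 ↔ P = 0 := by
    rw [← map_eq_zero_iff _ (IsFractionRing.injective (MvPolynomial (Fin 2) K) (RatFun K)),
      ← toRat, ← h1, mul_eq_zero, or_iff_left (pow_ne_zero _ hprod')]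
  rw [hP, mem_vanishingIdeal_iff]
  constructor
  · rintro rfl x ⟨u, hu, hx⟩
    obtain rfl : x = _ := funext hx
    have h := h2 u hu
    rw [map_zero] at h
    rw [aeval_eq_eval]
    refine (mul_eq_zero.mp h).resolve_right (pow_ne_zero _ ?_)
    rw [map_prod]
    exact Finset.prod_ne_zero_iff.mpr fun i _ => hu i
  · intro h
    -- The extra factor covers the parameters where $Q$ is undefined.
    have hz : P * ∏ i, D i = 0 := by
      refine MvPolynomial.funext fun u => ?_
      rw [map_zero, map_mul]
      by_cases hu : ∀ i, eval u (D i) ≠ 0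
      · rw [← h2 u hu]
        have := h _ ⟨u, hu, fun i => rfl⟩
        rw [aeval_eq_eval] at this
        have this' : eval (fun i => eval u (N i) / eval u (D i)) p = 0 := this
        rw [this', zero_mul, zero_mul]
      · push Not at hu
        obtain ⟨i, hi⟩ := hu
        rw [map_prod, Finset.prod_eq_zero (Finset.mem_univ i) hi, mul_zero]
    exact (mul_eq_zero.mp hz).resolve_right hprod

theorem IsDefiningPolynomial.vanishingIdeal_eq [IsAlgClosed K] {Z : Set (Fin 3 → K)}
    {f : MvPolynomial (Fin 3) K} (hf : IsDefiningPolynomial f Z) :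
    vanishingIdeal K Z = Ideal.span {f} := by
  have hprime : (Ideal.span {f}).IsPrime :=
    (Ideal.span_singleton_prime hf.1.ne_zero).mpr hf.1.prime
  have hZ : Z = zeroLocus K (Ideal.span {f}) := by
    rw [zeroLocus_span, hf.2]
    simp [aeval_eq_eval]
  rw [hZ, vanishingIdeal_zeroLocus_eq_radical, hprime.radical]

theorem aeval_paramFun_eq_zero_iff_dvd [IsAlgClosed K] {Z : Set (Fin 3 → K)}
    {f : MvPolynomial (Fin 3) K} (hf : IsDefiningPolynomial f Z) (hQ : IsParametrization N D Z)
    (p : MvPolynomial (Fin 3) K) : aeval (paramFun N D) p = 0 ↔ f ∣ p := by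
  rw [aeval_paramFun_eq_zero_iff hQ.den_ne_zero, ← Ideal.mem_span_singleton,
    ← hf.vanishingIdeal_eq, ← hQ.closure_image]
  have gc := zeroLocus_vanishingIdeal_galoisConnection (k := K) (K := K) (σ := Fin 3)
  have := gc.u_l_u_eq_u (OrderDual.toDual (paramImage N D))
  exact (Ideal.ext_iff.mp this p).symm

theorem IsDefiningPolynomial.one_lt_totalDegree {Z : Set (Fin 3 → K)}
    {f : MvPolynomial (Fin 3) K} (hf : IsDefiningPolynomial f Z) (hZ : ¬ IsPlane Z) :
    1 < f.totalDegree := by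
  by_contra h
  rcases Nat.le_one_iff_eq_zero_or_eq_one.mp (not_lt.mp h) with h | h
  · refine hf.1.not_isUnit (isUnit_iff_totalDegree_of_isReduced.mpr ⟨?_, h⟩)
    have h0 := totalDegree_eq_zero_iff_eq_C.mp h
    rw [isUnit_iff_ne_zero]
    intro h1
    rw [h1, C_0] at h0
    exact hf.1.ne_zero h0
  · exact hZ ⟨f, h, hf.2⟩

/-- The degree of the projection from `A` is the degree of the surface minus the multiplicity. -/
theorem exists_ratMapDegree_Phi [IsAlgClosed K] {Z : Set (Fin 3 → K)}
    {f : MvPolynomial (Fin 3) K} (hf : IsDefiningPolynomial f Z) (hQ : IsParametrization N D Z)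
    (hZ : ¬ IsPlane Z) (A : Fin 3 → K) : ∃ k : ℕ,
      f.totalDegree = multiplicityAt f A + k ∧
      ratMapDegree (Phi N D A) = k * ratMapDegree (paramFun N D) ∧
      (0 < k → AlgebraicIndependent K (Phi N D A)) := by
  have hrel := aeval_paramFun_eq_zero_iff_dvd hf hQ
  set v : Fin 3 → RatFun K := fun i => paramFun N D i - algebraMap K (RatFun K) (A i) with hv
  have hDi : ∀ i, toRat (D i) ≠ 0 := fun i => by
    rw [toRat, map_ne_zero_iff _ (IsFractionRing.injective _ _)]
    exact hQ.den_ne_zero i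
  have hC : ∀ a : K, toRat (C a : MvPolynomial (Fin 2) K) = algebraMap K (RatFun K) a :=
    fun a => rfl
  -- Otherwise `f`, of degree at least $2$, would divide $x - a$.
  have hw : v 0 ≠ 0 := by
    intro h0
    have h1 : f ∣ X 0 - C (A 0) := by
      rw [← hrel, map_sub, aeval_X, aeval_C]
      exact h0
    have hX : (X 0 - C (A 0) : MvPolynomial (Fin 3) K) ≠ 0 := fun h => by
      have := congrArg (eval fun _ => A 0 + 1) h
      simp at this
    have h2 := totalDegree_le_of_dvd_of_isDomain h1 hX
    have h3 : (X 0 - C (A 0) : MvPolynomial (Fin 3) K).totalDegree ≤ 1 :=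
      (totalDegree_sub _ _).trans (by simp)
    have := hf.one_lt_totalDegree hZ
    omega
  have hvdiv : ∀ i, v i = toRat (N i - C (A i) * D i) / toRat (D i) := fun i => by
    have := hDi i
    rw [hv, toRat, map_sub, map_mul, ← toRat, ← toRat, ← toRat, hC]
    simp only [paramFun]
    field_simp
  have hN0 : toRat (N 0 - C (A 0) * D 0) ≠ 0 := fun h => hw (by rw [hvdiv, h, zero_div])
  have hΦ0 : v 0 * Phi N D A 0 = v 1 := by
    have := hDi 0
    have := hDi 1
    rw [hvdiv, hvdiv, Phi, Matrix.cons_val_zero]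
    field_simp
  have hΦ1 : v 0 * Phi N D A 1 = v 2 := by
    have := hDi 0
    have := hDi 2
    rw [hvdiv, hvdiv, Phi, Matrix.cons_val_one, Matrix.cons_val_zero]
    field_simp
  have hvec : ![v 0, v 0 * Phi N D A 0, v 0 * Phi N D A 1] = v := by
    rw [hΦ0, hΦ1]
    ext i
    fin_cases i <;> rfl
  have hF0 : translate A f ≠ 0 := fun h => hf.1.ne_zero (by
    rw [← translate_neg_translate A f, h]; exact map_zero _)
  have hF : ∀ p : MvPolynomial (Fin 3) K,
      aeval ![v 0, v 0 * Phi N D A 0, v 0 * Phi N D A 1] p = 0 ↔ translate A f ∣ p := by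
    intro p
    rw [hvec, translate_dvd_iff, ← hrel, aeval_translate]
    simp [hv, sub_eq_add_neg]
  obtain ⟨G, hG, hG0, hdeg⟩ := exists_chart_eq_X_pow_mul hF0
  have hker := evalChart_eq_zero_iff hw hF hG hG0
  have hGne : G ≠ 0 := by rintro rfl; simp at hG0
  refine ⟨G.natDegree, by rw [← totalDegree_translate A f, hdeg]; rfl, ?_,
    algebraicIndependent_of_natDegree_pos hker⟩
  have hfin := finrank_adjoin_eq_natDegree hker hGne
  let E := IntermediateField.adjoin K (Set.range (Phi N D A))
  let M := IntermediateField.adjoin E {v 0}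
  have hvM : ∀ i, v i ∈ M := by
    have h0 : v 0 ∈ M := IntermediateField.mem_adjoin_simple_self E _
    have hE : ∀ i, Phi N D A i ∈ M := fun i =>
      M.algebraMap_mem ⟨_, IntermediateField.subset_adjoin K _ ⟨i, rfl⟩⟩
    intro i
    fin_cases i
    · exact h0
    · exact hΦ0 ▸ mul_mem h0 (hE 0)
    · exact hΦ1 ▸ mul_mem h0 (hE 1)
  have hM : M.restrictScalars K = IntermediateField.adjoin K (Set.range (paramFun N D)) := by
    have hvQ : ∀ i, v i ∈ IntermediateField.adjoin K (Set.range (paramFun N D)) := fun i =>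
      sub_mem (IntermediateField.subset_adjoin K _ ⟨i, rfl⟩) (IntermediateField.algebraMap_mem _ _)
    apply le_antisymm
    · rw [IntermediateField.restrictScalars_adjoin_eq_sup, sup_le_iff]
      constructor
      · rw [IntermediateField.adjoin_le_iff]
        rintro _ ⟨i, rfl⟩
        fin_cases i
        · exact (eq_div_of_mul_eq hw ((mul_comm _ _).trans hΦ0)) ▸ div_mem (hvQ 1) (hvQ 0)
        · exact (eq_div_of_mul_eq hw ((mul_comm _ _).trans hΦ1)) ▸ div_mem (hvQ 2) (hvQ 0)
      · rw [IntermediateField.adjoin_le_iff]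
        rintro _ rfl
        exact hvQ 0
    · rw [IntermediateField.adjoin_le_iff]
      rintro _ ⟨i, rfl⟩
      have : paramFun N D i = v i + algebraMap K (RatFun K) (A i) := by simp [hv]
      rw [this]
      exact add_mem (hvM i) ((M.restrictScalars K).algebraMap_mem _)
  have hrm : ratMapDegree (paramFun N D) = Module.finrank M (RatFun K) := by
    rw [ratMapDegree, ← hM]
    rfl
  rw [hrm, ← hfin, ratMapDegree]
  -- Tower law for $K(\Phi) \subseteq K(Q) \subseteq K(t,s)$.
  exact (Module.finrank_mul_finrank E M (RatFun K)).symm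

end Relations

end RationalSurface

end

theorem mainTheorem3 {K : Type*} [Field K] [IsAlgClosed K] [CharZero K]
    (Z : Set (Fin 3 → K)) (f : MvPolynomial (Fin 3) K)
    (hf : RationalSurface.IsDefiningPolynomial f Z)
    (N D : Fin 3 → MvPolynomial (Fin 2) K)
    (hQ : RationalSurface.IsParametrization N D Z)
    (hZ : ¬ RationalSurface.IsPlane Z)
    (A₀ A : Fin 3 → K) (hA₀ : A₀ ∉ Z) :
    RationalSurface.IsSimplePoint f A ↔
      RationalSurface.gPoly N D A = 1 ∧
        (RationalSurface.ratMapDegree (RationalSurface.Phi N D A₀) : ℤ)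
            - (RationalSurface.ratMapDegree (RationalSurface.Phi N D A) : ℤ)
          = (RationalSurface.ratMapDegree (RationalSurface.paramFun N D) : ℤ) := by
  have hd := hf.one_lt_totalDegree hZ
  obtain ⟨k₀, hk₀, hdeg₀, hind₀⟩ := RationalSurface.exists_ratMapDegree_Phi hf hQ hZ A₀
  obtain ⟨k, hk, hdeg, hind⟩ := RationalSurface.exists_ratMapDegree_Phi hf hQ hZ A
  have hm₀ : RationalSurface.multiplicityAt f A₀ = 0 :=
    RationalSurface.multiplicityAt_eq_zero fun h => hA₀ (by rw [hf.2]; exact h)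
  -- As $A_0 \notin Z$, $k_0 = \deg f > 0$: the projection from $A_0$ has finite, nonzero degree,
  -- and $\deg Q$ divides it.
  have hq : RationalSurface.ratMapDegree (RationalSurface.paramFun N D) ≠ 0 := by
    have hpos := RationalSurface.ratMapDegree_pos (hind₀ (by omega))
    rw [hdeg₀] at hpos
    exact (Nat.pos_of_mul_pos_left hpos).ne'
  have hk₀k : (k₀ : ℤ) = RationalSurface.multiplicityAt f A + k := by omega
  have hdiff : (RationalSurface.ratMapDegree (RationalSurface.Phi N D A₀) : ℤ)
        - (RationalSurface.ratMapDegree (RationalSurface.Phi N D A) : ℤ)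
      = RationalSurface.multiplicityAt f A *
        (RationalSurface.ratMapDegree (RationalSurface.paramFun N D) : ℤ) := by
    rw [hdeg₀, hdeg, Nat.cast_mul, Nat.cast_mul, hk₀k]
    ring
  rw [hdiff, mul_eq_right₀ (by exact_mod_cast hq), Nat.cast_eq_one]
  refine ⟨fun h => ⟨?_, h⟩, fun h => h.2⟩
  have hm : RationalSurface.multiplicityAt f A = 1 := h
  exact RationalSurface.gPoly_eq_one_of_algebraicIndependent (hind (by omega))
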